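/- Let $n\ge 2$ be an integer and let $p,q$ be real numbers with $2\le p<q<p+\frac{p}{n-1}$. Then there exist constants $\theta=\theta(n,p,q)\in(0,1)$ and $c=c(n,p,q)>1$ such that the following holds. Let $x_0\in\mathbb R^n$, $t_0\in\mathbb R$, $R,\ell>0$, and put $B=\{x\in\mathbb R^n:|x-x_0|<R\}$, $I=(t_0-\ell,t_0)$ and $Q=B\times I$. Then for every real-valued function $$f\in C(I;L^2(B))\cap L^p(I;W^{1,p}(B)),$$ with weak spatial gradient $Df$, we have $$ \frac1{|Q|}\iint_{Q}\left|\frac fR\right|^{q}dx\,dt\;\le\; c\left(\frac1{|Q|}\iint_{Q}\left[|Df|^p+\left|\frac fR\right|^p\right]dx\,dt\right)^{\frac{q\theta}{p}}\left(\sup_{t\in I}\frac1{|B|}\int_{B}\left|\frac{f(x,t)}R\right|^2dx\right)^{\frac{q(1-\theta)}2}, $$ where the supremum, and hence the right-hand side, may be $+\infty$. -/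

import Mathlib

open MeasureTheory Set
open scoped ENNReal ContDiff

/-- Euclidean `n`-space. -/
abbrev Rn (n : ℕ) : Type := EuclideanSpace ℝ (Fin n)

/-- The backward time interval `(t₀ - ℓ, t₀)`. -/
def timeInterval (t₀ ℓ : ℝ) : Set ℝ := Ioo (t₀ - ℓ) t₀

/-- The parabolic cylinder `B_R(x₀) × (t₀ - ℓ, t₀)`. -/
def parabolicCylinder {n : ℕ} (x₀ : Rn n) (t₀ R ℓ : ℝ) : Set (Rn n × ℝ) :=
  Metric.ball x₀ R ×ˢ timeInterval t₀ ℓ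

/-- `g` is the weak (distributional) gradient of `u` on the open set `U`:
`∫_U u ∂ᵢφ = - ∫_U gᵢ φ` for every `φ ∈ C_c^∞(U)` and every `i`. -/
def IsWeakGradient {n : ℕ} (U : Set (Rn n)) (u : Rn n → ℝ) (g : Rn n → Rn n) : Prop :=
  LocallyIntegrableOn u U ∧ LocallyIntegrableOn g U ∧
    ∀ φ : Rn n → ℝ, ContDiff ℝ ∞ φ → HasCompactSupport φ → tsupport φ ⊆ U →
      ∀ i : Fin n,
        ∫ x in U, u x * fderiv ℝ φ x (EuclideanSpace.single i 1) = - ∫ x in U, g x i * φ x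

/-- `G = Df` on `U × I`: a jointly measurable field which is, at almost every time `t ∈ I`, the weak
gradient in space of `f(·, t)`. It is unique up to a null subset of `U × I`. -/
def IsSpatialGradient {n : ℕ} (I : Set ℝ) (U : Set (Rn n)) (f : Rn n × ℝ → ℝ)
    (G : Rn n × ℝ → Rn n) : Prop :=
  AEStronglyMeasurable G (volume.restrict (U ×ˢ I)) ∧
    ∀ᵐ t ∂(volume.restrict I), IsWeakGradient U (fun x => f (x, t)) (fun x => G (x, t))

/-- `f ∈ C(I; L²(U))`: every time slice is in `L²(U)`, and the slices depend continuously on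
`t ∈ I` in the norm of `L²(U)`. -/
def MemCL2 {n : ℕ} (I : Set ℝ) (U : Set (Rn n)) (f : Rn n × ℝ → ℝ) : Prop :=
  ∃ F : ℝ → Lp ℝ 2 (volume.restrict U), ContinuousOn F I ∧
    ∀ t ∈ I, (F t : Rn n → ℝ) =ᵐ[volume.restrict U] fun x => f (x, t)

/-- `f ∈ L^p(I; W^{1,p}(U))` for `1 ≤ p < ∞`, for functions on the product `U × I`: almost every
time slice has a weak gradient, and `f` and `Df` are (measurable and) `p`-integrable over `U × I`,
i.e. `∫_I ‖f(·, t)‖^p_{W^{1,p}(U)} dt < ∞`. -/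
def MemLpW1p {n : ℕ} (p : ℝ) (I : Set ℝ) (U : Set (Rn n)) (f : Rn n × ℝ → ℝ) : Prop :=
  MemLp f (ENNReal.ofReal p) (volume.restrict (U ×ˢ I)) ∧
    ∃ G : Rn n × ℝ → Rn n, IsSpatialGradient I U f G ∧
      MemLp G (ENNReal.ofReal p) (volume.restrict (U ×ˢ I))

/-!
The inequality holds with `θ = p / q`, for which the energy appears linearly and the second factor has
the exponent `(q - p) / 2`. It is then enough to prove, on almost every time slice, the interpolation
inequality
`∫_B |u / R|^q ≤ C (⨍_B |u / R|²)^((q - p) / 2) ∫_B (|Du|^p + |u / R|^p)`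
(`gagliardo_nirenberg_ball_normalized`), to bound the mean square by its supremum over time, and to
integrate in time.

The slice inequality holds in the range `p < q < p + 2p / n`, which contains the given one because
`n ≤ 2(n - 1)`. For smooth `u` it comes from a weak-type estimate at the endpoint `p + 2p / n`. Compare
`u(x)` with the average of `u` over `(1 - r) x + r B`, a ball of radius `r R` inside `B`. The average is
at most `r^(-n/2) σ` with `σ² = ⨍_B |u|²`, and the `L^p` distance of `u` to its averages is at most
`C R r ‖Du‖_p` (`setLIntegral_ball_sub_homothety_le`). If `r` is chosen such that `r^(-n/2) σ = λ`, this
bounds the measure of `{|u| > 2λ}` by `C λ^(-p - 2p/n) σ^(2p/n) R^p ‖Du‖_p^p` for all `λ ≥ 2^(n/2) σ`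
(`mul_meas_lt_enorm_le_of_contDiff`). The layer cake formula turns this into the strong estimate for
every smaller exponent, where the levels below a multiple of `σ` are absorbed by the `L^p` norm of `u`
(`lintegral_rpow_le_of_meas_lt_le`).

Functions with a weak gradient are mollified on slightly smaller balls: mollification contracts the
norms on the right-hand side (`lintegral_normed_convolution_rpow_le`,
`enorm_fderiv_normed_convolution_le`), and Fatou's lemma handles the left-hand side.
-/

open ContinuousLinearMap (lsmul)
open scoped Convolution Topology

/-! ### Jensen's inequality and dilations of balls -/

/-- Jensen's inequality for the convex function `y ↦ y ^ s` and a probability measure, for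
`ℝ≥0∞`-valued functions. -/
theorem rpow_lintegral_le_lintegral_rpow {α : Type*} {m : MeasurableSpace α} {ν : Measure α}
    [IsProbabilityMeasure ν] {h : α → ℝ≥0∞} (hh : AEMeasurable h ν) {s : ℝ} (hs : 1 ≤ s) :
    (∫⁻ x, h x ∂ν) ^ s ≤ ∫⁻ x, h x ^ s ∂ν := by
  have h0 : 0 < s := by linarith
  have := eLpNorm'_le_eLpNorm'_of_exponent_le one_pos hs ν hh.aestronglyMeasurable
  simp only [eLpNorm', enorm_eq_self, ENNReal.rpow_one, div_one] at this
  rw [one_div, ENNReal.le_rpow_inv_iff h0] at this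
  exact this

theorem lintegral_comp_smul_add {n : ℕ} (g : Rn n → ℝ≥0∞) {a : ℝ} (ha : 0 < a) (w : Rn n) :
    ∫⁻ x, g (a • x + w) = ENNReal.ofReal (a ^ (-(n : ℝ))) * ∫⁻ x, g x := by
  have e := MeasureTheory.Measure.map_addHaar_smul (volume : Measure (Rn n)) ha.ne'
  have h1 : ∫⁻ x, g (a • x + w) = ∫⁻ y, g (y + w) ∂(Measure.map (a • ·) volume) :=
    ((Homeomorph.smulOfNeZero a ha.ne').measurableEmbedding.lintegral_map
      (fun y => g (y + w))).symm
  rw [h1, e, lintegral_smul_measure, lintegral_add_right_eq_self, smul_eq_mul,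
    finrank_euclideanSpace_fin, abs_of_pos (by positivity), Real.rpow_neg ha.le,
    Real.rpow_natCast]

/-- A dilation with ratio `a ≤ 1` centred at a point `z` of the ball maps the ball into itself, so
composition with it costs only the Jacobian `a ^ (-n)`. -/
theorem setLIntegral_ball_comp_homothety_le {n : ℕ} (g : Rn n → ℝ≥0∞) {x₀ z : Rn n} {R a : ℝ}
    (hz : z ∈ Metric.ball x₀ R) (ha : 0 < a) (ha1 : a ≤ 1) :
    ∫⁻ x in Metric.ball x₀ R, g (a • x + (1 - a) • z) ≤
      ENNReal.ofReal (a ^ (-(n : ℝ))) * ∫⁻ x in Metric.ball x₀ R, g x := by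
  have hB := Metric.isOpen_ball (x := x₀) (ε := R) |>.measurableSet
  rw [← lintegral_indicator hB, ← lintegral_indicator hB,
    ← lintegral_comp_smul_add _ ha ((1 - a) • z)]
  refine lintegral_mono fun x => ?_
  by_cases hx : x ∈ Metric.ball x₀ R
  · have : a • x + (1 - a) • z ∈ Metric.ball x₀ R :=
      convex_ball x₀ R hx hz ha.le (by linarith) (by ring)
    simp [indicator_of_mem hx, indicator_of_mem this]
  · simp [indicator_of_notMem hx]

/-! ### Distance of a smooth function from its averages over small balls -/

theorem enorm_sub_le_lintegral_fderiv {E : Type*} [NormedAddCommGroup E] [NormedSpace ℝ E]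
    {u : E → ℝ} (hu : ContDiff ℝ 1 u) (x v : E) :
    ‖u (x + v) - u x‖ₑ ≤ ∫⁻ s in Icc (0 : ℝ) 1, ‖fderiv ℝ u (x + s • v)‖ₑ * ‖v‖ₑ := by
  have hγ : ∀ s : ℝ, HasDerivAt (fun s : ℝ => x + s • v) v s := fun s => by
    simpa using ((hasDerivAt_id s).smul_const v).const_add x
  have hc : ContDiff ℝ 1 (fun s : ℝ => u (x + s • v)) := by fun_prop
  have h := enorm_sub_le_lintegral_deriv_of_contDiffOn_Icc hc.contDiffOn zero_le_one
  simp only [one_smul, zero_smul, add_zero] at h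
  refine h.trans (lintegral_mono fun s => ?_)
  have hd : HasDerivAt (fun s : ℝ => u (x + s • v)) (fderiv ℝ u (x + s • v) v) s :=
    ((hu.differentiable one_ne_zero) _).hasFDerivAt.comp_hasDerivAt s (hγ s)
  rw [hd.deriv]
  exact (fderiv ℝ u (x + s • v)).le_opENorm v

/-- The `L^p` distance between `u` and its composition with the contraction of the ball towards `z`
with ratio `1 - r` is `O(R r ‖Du‖_p)`: integrate `Du` along the segment from `x` to
`r z + (1 - r) x`, and undo the contraction by `(1 - s r) x + s r z`, whose Jacobian is bounded below
as `r ≤ 1 / 2`. -/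
theorem setLIntegral_ball_sub_homothety_le {n : ℕ} {u : Rn n → ℝ} (hu : ContDiff ℝ 1 u)
    {x₀ z : Rn n} {R r p : ℝ} (hz : z ∈ Metric.ball x₀ R) (hr : 0 < r) (hr2 : r ≤ 1 / 2)
    (hp : 1 ≤ p) :
    ∫⁻ x in Metric.ball x₀ R, ‖u x - u (r • z + (1 - r) • x)‖ₑ ^ p ≤
      ENNReal.ofReal (2 ^ (n : ℝ) * (2 * R * r) ^ p) *
        ∫⁻ x in Metric.ball x₀ R, ‖fderiv ℝ u x‖ₑ ^ p := by
  have hp0 : 0 < p := by linarith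
  have hR : 0 < R := Metric.pos_of_mem_ball hz
  have hB := Metric.isOpen_ball (x := x₀) (ε := R) |>.measurableSet
  have hcd : Continuous (fderiv ℝ u) := hu.continuous_fderiv one_ne_zero
  have : IsProbabilityMeasure (volume.restrict (Icc (0 : ℝ) 1)) := ⟨by simp⟩
  have key : ∀ x ∈ Metric.ball x₀ R, ‖u x - u (r • z + (1 - r) • x)‖ₑ ^ p ≤
      ENNReal.ofReal ((2 * R * r) ^ p) *
        ∫⁻ s in Icc (0 : ℝ) 1, ‖fderiv ℝ u ((1 - s * r) • x + (s * r) • z)‖ₑ ^ p := by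
    intro x hx
    have h := enorm_sub_le_lintegral_fderiv hu x (r • (z - x))
    have e1 : x + r • (z - x) = r • z + (1 - r) • x := by module
    have hv : ‖r • (z - x)‖ₑ ≤ ENNReal.ofReal (2 * R * r) := by
      rw [← ofReal_norm]
      apply ENNReal.ofReal_le_ofReal
      rw [norm_smul, Real.norm_of_nonneg hr.le, mul_comm]
      gcongr
      rw [← dist_eq_norm]
      have := dist_triangle_right z x x₀
      rw [Metric.mem_ball] at hx hz
      linarith
    have hm : Measurable fun s : ℝ => ‖fderiv ℝ u (x + s • (r • (z - x)))‖ₑ :=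
      (Continuous.enorm (by fun_prop)).measurable
    calc ‖u x - u (r • z + (1 - r) • x)‖ₑ ^ p
        ≤ ((∫⁻ s in Icc (0 : ℝ) 1, ‖fderiv ℝ u (x + s • (r • (z - x)))‖ₑ) *
            ENNReal.ofReal (2 * R * r)) ^ p := by
          gcongr
          rw [← enorm_neg, neg_sub, ← e1]
          refine h.trans ?_
          rw [lintegral_mul_const _ hm]
          gcongr
      _ ≤ (∫⁻ s in Icc (0 : ℝ) 1, ‖fderiv ℝ u (x + s • (r • (z - x)))‖ₑ ^ p) *
            ENNReal.ofReal ((2 * R * r) ^ p) := by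
          rw [ENNReal.mul_rpow_of_nonneg _ _ hp0.le,
            ENNReal.ofReal_rpow_of_nonneg (by positivity) hp0.le]
          gcongr
          exact rpow_lintegral_le_lintegral_rpow hm.aemeasurable hp
      _ = _ := by
          rw [mul_comm]
          congr 2 with s
          congr 3
          module
  calc _ ≤ ∫⁻ x in Metric.ball x₀ R, ENNReal.ofReal ((2 * R * r) ^ p) *
        ∫⁻ s in Icc (0 : ℝ) 1, ‖fderiv ℝ u ((1 - s * r) • x + (s * r) • z)‖ₑ ^ p :=
        setLIntegral_mono' hB key
    _ = ENNReal.ofReal ((2 * R * r) ^ p) * ∫⁻ s in Icc (0 : ℝ) 1, ∫⁻ x in Metric.ball x₀ R,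
          ‖fderiv ℝ u ((1 - s * r) • x + (s * r) • z)‖ₑ ^ p := by
        rw [lintegral_const_mul' _ _ ENNReal.ofReal_ne_top, lintegral_lintegral_swap]
        refine Measurable.aemeasurable (Measurable.pow_const (Continuous.measurable ?_) _)
        exact Continuous.enorm (by fun_prop)
    _ ≤ ENNReal.ofReal ((2 * R * r) ^ p) * ∫⁻ s in Icc (0 : ℝ) 1,
          ENNReal.ofReal (2 ^ (n : ℝ)) * ∫⁻ x in Metric.ball x₀ R, ‖fderiv ℝ u x‖ₑ ^ p := by
        gcongr 1
        refine setLIntegral_mono' measurableSet_Icc fun s hs => ?_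
        have hsr : s * r ≤ 1 / 2 := by nlinarith [hs.1, hs.2]
        have := setLIntegral_ball_comp_homothety_le (fun y => ‖fderiv ℝ u y‖ₑ ^ p) hz
          (a := 1 - s * r) (by linarith) (by nlinarith [hs.1])
        rw [sub_sub_cancel] at this
        refine this.trans ?_
        gcongr
        have h2 : (2 : ℝ) ^ (n : ℝ) = (1 / 2 : ℝ) ^ (-(n : ℝ)) := by
          rw [one_div, Real.inv_rpow (by norm_num), Real.rpow_neg (by norm_num), inv_inv]
        rw [h2]
        exact Real.rpow_le_rpow_of_nonpos (by norm_num) (by linarith) (by simp)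
    _ = _ := by
        rw [lintegral_const]
        simp only [measure_univ, mul_one]
        rw [← mul_assoc, ← ENNReal.ofReal_mul (by positivity), mul_comm ((2 * R * r) ^ p)]

/-- A weak-type estimate for the level sets of `u`. If `|u(x)| > 2λ`, while the average of `|u|` over
the ball `{r z + (1 - r) x : z ∈ B}` of radius `r R` is at most `λ`, then `u` is at distance at least
`λ` from that average, and the distance is controlled in `L^p` by the gradient. By Jensen's
inequality, `r ^ (-n) ⨍_B |u|² ≤ λ²` is enough for the bound on the averages. -/
theorem mul_meas_lt_enorm_le_of_contDiff {n : ℕ} {u : Rn n → ℝ} (hu : ContDiff ℝ 1 u)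
    {x₀ : Rn n} {R r p : ℝ} (hR : 0 < R) (hr : 0 < r) (hr2 : r ≤ 1 / 2)
    (hp : 1 ≤ p) {lam : ℝ≥0∞} (hlam : lam ≠ ⊤)
    (hM : ENNReal.ofReal (r ^ (-(n : ℝ))) * ((volume (Metric.ball x₀ R))⁻¹ *
      ∫⁻ x in Metric.ball x₀ R, ‖u x‖ₑ ^ (2 : ℝ)) ≤ lam ^ (2 : ℝ)) :
    lam ^ p * volume.restrict (Metric.ball x₀ R) {x | 2 * lam < ‖u x‖ₑ} ≤
      ENNReal.ofReal (2 ^ (n : ℝ) * (2 * R * r) ^ p) *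
        ∫⁻ x in Metric.ball x₀ R, ‖fderiv ℝ u x‖ₑ ^ p := by
  have hp0 : 0 < p := by linarith
  have hB := Metric.isOpen_ball (x := x₀) (ε := R) |>.measurableSet
  have hV0 : volume (Metric.ball x₀ R) ≠ 0 := (Metric.measure_ball_pos volume x₀ hR).ne'
  have hVt : volume (Metric.ball x₀ R) ≠ ⊤ := measure_ball_lt_top.ne
  set B := Metric.ball x₀ R with hBdef
  set ν : Measure (Rn n) := (volume B)⁻¹ • volume.restrict B with hν
  have hprob : IsProbabilityMeasure ν := ⟨by
    rw [hν, Measure.smul_apply, Measure.restrict_apply_univ, smul_eq_mul,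
      ENNReal.inv_mul_cancel hV0 hVt]⟩
  have hcu := hu.continuous
  have hm1 : ∀ x, Measurable fun z => ‖u (r • z + (1 - r) • x)‖ₑ := fun x =>
    (Continuous.enorm (by fun_prop)).measurable
  have hm2 : ∀ x, Measurable fun z => ‖u x - u (r • z + (1 - r) • x)‖ₑ := fun x =>
    (Continuous.enorm (by fun_prop)).measurable
  have hm3 : Measurable (Function.uncurry fun x z : Rn n =>
      ‖u x - u (r • z + (1 - r) • x)‖ₑ ^ p) := by
    refine Measurable.pow_const (Continuous.measurable ?_) _
    exact Continuous.enorm (by fun_prop)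
  have hlow : ∀ x ∈ B, ∫⁻ z, ‖u (r • z + (1 - r) • x)‖ₑ ∂ν ≤ lam := by
    intro x hx
    rw [← ENNReal.rpow_le_rpow_iff (two_pos : (0 : ℝ) < 2)]
    refine (rpow_lintegral_le_lintegral_rpow (hm1 x).aemeasurable one_le_two).trans
      (le_trans ?_ hM)
    rw [hν, lintegral_smul_measure, smul_eq_mul, mul_left_comm]
    gcongr
    exact setLIntegral_ball_comp_homothety_le (fun y => ‖u y‖ₑ ^ (2 : ℝ)) hx hr (by linarith)
  have hpt : ∀ x ∈ B, 2 * lam < ‖u x‖ₑ →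
      lam ^ p ≤ ∫⁻ z, ‖u x - u (r • z + (1 - r) • x)‖ₑ ^ p ∂ν := by
    intro x hx hux
    refine le_trans ?_ (rpow_lintegral_le_lintegral_rpow (hm2 x).aemeasurable hp)
    gcongr
    have h1 : ‖u x‖ₑ ≤ ∫⁻ z, ‖u x - u (r • z + (1 - r) • x)‖ₑ ∂ν + lam := by
      calc ‖u x‖ₑ = ∫⁻ _, ‖u x‖ₑ ∂ν := by simp
        _ ≤ ∫⁻ z, (‖u x - u (r • z + (1 - r) • x)‖ₑ + ‖u (r • z + (1 - r) • x)‖ₑ) ∂ν := by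
            refine lintegral_mono fun z => ?_
            refine le_trans (le_of_eq ?_) (enorm_add_le _ _)
            rw [sub_add_cancel]
        _ = ∫⁻ z, ‖u x - u (r • z + (1 - r) • x)‖ₑ ∂ν +
              ∫⁻ z, ‖u (r • z + (1 - r) • x)‖ₑ ∂ν := lintegral_add_left (hm2 x) _
        _ ≤ _ := by gcongr; exact hlow x hx
    have h2 := hux.le.trans h1
    rw [two_mul] at h2
    exact (ENNReal.add_le_add_iff_right hlam).1 h2
  calc _ ≤ lam ^ p * volume.restrict B
          {x | lam ^ p ≤ ∫⁻ z, ‖u x - u (r • z + (1 - r) • x)‖ₑ ^ p ∂ν} := by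
        gcongr 1
        refine measure_mono_ae ?_
        filter_upwards [ae_restrict_mem hB] with x hx h
        exact hpt x hx h
    _ ≤ ∫⁻ x in B, ∫⁻ z, ‖u x - u (r • z + (1 - r) • x)‖ₑ ^ p ∂ν :=
        mul_meas_ge_le_lintegral₀ hm3.lintegral_prod_right.aemeasurable _
    _ = ∫⁻ z, (∫⁻ x in B, ‖u x - u (r • z + (1 - r) • x)‖ₑ ^ p) ∂ν :=
        lintegral_lintegral_swap hm3.aemeasurable
    _ ≤ ∫⁻ _, (ENNReal.ofReal (2 ^ (n : ℝ) * (2 * R * r) ^ p) *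
          ∫⁻ x in B, ‖fderiv ℝ u x‖ₑ ^ p) ∂ν := by
        refine lintegral_mono_ae ?_
        refine Measure.ae_smul_measure ?_ _
        filter_upwards [ae_restrict_mem hB] with z hz
        exact setLIntegral_ball_sub_homothety_le hu hz hr hr2 hp
    _ = _ := by rw [lintegral_const, measure_univ, mul_one]

/-! ### The interpolation inequality for smooth functions -/

/-- If the distribution function of `f` decays like `t ^ (-s)` beyond the level `T`, then for
`p ≤ q < s` the `L^q` integral of `f` is controlled by its `L^p` integral (levels below `T`) and by the
decay (levels above `T`). -/
theorem lintegral_rpow_le_of_meas_lt_le {α : Type*} {m : MeasurableSpace α} {μ : Measure α}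
    {f : α → ℝ} (hf0 : 0 ≤ᵐ[μ] f) (hf : AEMeasurable f μ) {p q s T K : ℝ} (hp : 1 ≤ p)
    (hpq : p ≤ q) (hqs : q < s) (hT : 0 < T) (hK : 0 ≤ K) {D : ℝ≥0∞}
    (h : ∀ t, T < t → μ {a | t < f a} ≤ ENNReal.ofReal (K * t ^ (-s)) * D) :
    ∫⁻ a, ENNReal.ofReal (f a ^ q) ∂μ ≤ ENNReal.ofReal q *
      (ENNReal.ofReal (T ^ (q - p)) * ∫⁻ a, ENNReal.ofReal (f a ^ p) ∂μ +
        ENNReal.ofReal (K * (T ^ (q - s) / (s - q))) * D) := by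
  have hp0 : 0 < p := by linarith
  have hlow : ∫⁻ t in Ioc 0 T, μ {a | t < f a} * ENNReal.ofReal (t ^ (q - 1)) ≤
      ENNReal.ofReal (T ^ (q - p)) * ∫⁻ a, ENNReal.ofReal (f a ^ p) ∂μ := by
    rw [lintegral_rpow_eq_lintegral_meas_lt_mul μ hf0 hf hp0]
    calc ∫⁻ t in Ioc 0 T, μ {a | t < f a} * ENNReal.ofReal (t ^ (q - 1))
        ≤ ∫⁻ t in Ioc 0 T, ENNReal.ofReal (T ^ (q - p)) *
            (μ {a | t < f a} * ENNReal.ofReal (t ^ (p - 1))) := by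
          refine setLIntegral_mono' measurableSet_Ioc fun t ht => ?_
          rw [mul_left_comm, ← ENNReal.ofReal_mul (by positivity)]
          gcongr
          have : t ^ (q - 1) = t ^ (q - p) * t ^ (p - 1) := by
            rw [← Real.rpow_add ht.1]; congr 1; ring
          rw [this]
          exact mul_le_mul_of_nonneg_right (Real.rpow_le_rpow ht.1.le ht.2 (by linarith))
            (Real.rpow_nonneg ht.1.le _)
      _ ≤ ENNReal.ofReal (T ^ (q - p)) *
            ∫⁻ t in Ioi 0, μ {a | t < f a} * ENNReal.ofReal (t ^ (p - 1)) := by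
          rw [lintegral_const_mul' _ _ ENNReal.ofReal_ne_top]
          gcongr
          exact Ioc_subset_Ioi_self
      _ ≤ _ := by
          gcongr
          exact le_mul_of_one_le_left' (by simpa using hp)
  have hhigh : ∫⁻ t in Ioi T, μ {a | t < f a} * ENNReal.ofReal (t ^ (q - 1)) ≤
      ENNReal.ofReal (K * (T ^ (q - s) / (s - q))) * D := by
    have hint := integrableOn_Ioi_rpow_of_lt (a := q - s - 1) (by linarith) hT
    have hval := integral_Ioi_rpow_of_lt (a := q - s - 1) (by linarith) hT
    calc ∫⁻ t in Ioi T, μ {a | t < f a} * ENNReal.ofReal (t ^ (q - 1))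
        ≤ ∫⁻ t in Ioi T, ENNReal.ofReal K * (ENNReal.ofReal (t ^ (q - s - 1)) * D) := by
          refine setLIntegral_mono' measurableSet_Ioi fun t ht => ?_
          have ht0 : 0 < t := hT.trans ht
          have e : t ^ (q - s - 1) = t ^ (-s) * t ^ (q - 1) := by
            rw [← Real.rpow_add ht0]; congr 1; ring
          refine (mul_le_mul_left (h t ht) _).trans (le_of_eq ?_)
          rw [e, ENNReal.ofReal_mul hK, ENNReal.ofReal_mul (by positivity)]
          ring
      _ = ENNReal.ofReal K * ((∫⁻ t in Ioi T, ENNReal.ofReal (t ^ (q - s - 1))) * D) := by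
          rw [lintegral_const_mul' _ _ ENNReal.ofReal_ne_top, lintegral_mul_const]
          fun_prop
      _ = _ := by
          rw [← ofReal_integral_eq_lintegral_ofReal hint, hval, ENNReal.ofReal_mul hK, mul_assoc]
          · congr 3
            rw [show q - s - 1 + 1 = q - s by ring, ← neg_sub s q, neg_div_neg_eq]
          · filter_upwards [ae_restrict_mem measurableSet_Ioi] with t ht
            exact Real.rpow_nonneg (hT.trans ht).le _
  rw [lintegral_rpow_eq_lintegral_meas_lt_mul μ hf0 hf (by linarith), ← Ioc_union_Ioi_eq_Ioi hT.le]
  gcongr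
  exact (lintegral_union_le _ _ _).trans (add_le_add hlow hhigh)

/-- The interpolation inequality on balls for functions that are `C¹` on the whole space, with a
constant that depends only on `n`, `p`, `q`. -/
theorem gagliardo_nirenberg_ball_of_contDiff {n : ℕ} (hn : 0 < n) {p q : ℝ} (hp : 1 ≤ p)
    (hpq : p < q) (hq : q < p + 2 * p / n) :
    ∃ C : ℝ, 0 < C ∧ ∀ (u : Rn n → ℝ) (x₀ : Rn n) (R : ℝ), ContDiff ℝ 1 u → 0 < R →
      ∫⁻ x in Metric.ball x₀ R, ‖u x‖ₑ ^ q ≤ ENNReal.ofReal C *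
        ((volume (Metric.ball x₀ R))⁻¹ *
          ∫⁻ x in Metric.ball x₀ R, ‖u x‖ₑ ^ (2 : ℝ)) ^ ((q - p) / 2) *
        ((∫⁻ x in Metric.ball x₀ R, ‖u x‖ₑ ^ p) +
          ENNReal.ofReal (R ^ p) * ∫⁻ x in Metric.ball x₀ R, ‖fderiv ℝ u x‖ₑ ^ p) := by
  have hn' : (0 : ℝ) < n := by exact_mod_cast hn
  set s : ℝ := p + 2 * p / n with hs
  -- `A σ` is the level, `σ` being the root mean square of `u`, beyond which the radius `r` in
  -- `mul_meas_lt_enorm_le_of_contDiff` is at most `1 / 2`.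
  set A : ℝ := 2 * 2 ^ ((n : ℝ) / 2) with hA
  have hA0 : 0 < A := by positivity
  have hsq : 0 < s - q := by linarith
  have hp0 : 0 < p := by linarith
  have hq0 : 0 < q := by linarith
  set c₁ : ℝ := A ^ (q - p) with hc₁
  set c₂ : ℝ := 2 ^ (n : ℝ) * 2 ^ p * 2 ^ s * (A ^ (q - s) / (s - q)) with hc₂
  have hc₁0 : 0 < c₁ := by positivity
  have hc₂0 : 0 < c₂ := by positivity
  refine ⟨q * (c₁ + c₂), by positivity, fun u x₀ R hu hR => ?_⟩
  have hV0 : volume (Metric.ball x₀ R) ≠ 0 := (Metric.measure_ball_pos volume x₀ hR).ne'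
  have hVt : volume (Metric.ball x₀ R) ≠ ⊤ := measure_ball_lt_top.ne
  have hcu := hu.continuous
  have hm2 : Measurable fun x => ‖u x‖ₑ ^ (2 : ℝ) := hcu.enorm.measurable.pow_const _
  have hnorm : ∀ (a : ℝ), 0 ≤ a → ∀ x, ENNReal.ofReal (|u x| ^ a) = ‖u x‖ₑ ^ a := fun a ha x => by
    rw [← ENNReal.ofReal_rpow_of_nonneg (abs_nonneg _) ha, Real.enorm_eq_ofReal_abs]
  set M : ENNReal := (volume (Metric.ball x₀ R))⁻¹ *
          ∫⁻ x in Metric.ball x₀ R, ‖u x‖ₑ ^ (2 : ℝ) with hM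
  have hMt : M ≠ ⊤ := by
    refine ENNReal.mul_ne_top (ENNReal.inv_ne_top.2 hV0) ?_
    have h1 : IntegrableOn (fun x => |u x| ^ (2 : ℝ)) (Metric.ball x₀ R) :=
      ((hcu.abs.rpow_const fun _ => Or.inr zero_le_two).continuousOn.integrableOn_compact
        (isCompact_closedBall x₀ R)).mono_set Metric.ball_subset_closedBall
    have := h1.lintegral_lt_top.ne
    simpa only [hnorm 2 zero_le_two] using this
  -- If `u` vanishes almost everywhere on the ball, the left-hand side is zero.
  rcases eq_or_ne M 0 with hM0 | hM0
  · have h0 : ∫⁻ x in Metric.ball x₀ R, ‖u x‖ₑ ^ (2 : ℝ) = 0 := by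
      rcases mul_eq_zero.1 hM0 with h | h
      · exact absurd h (ENNReal.inv_ne_zero.2 hVt)
      · exact h
    rw [lintegral_eq_zero_iff hm2] at h0
    have : ∫⁻ x in Metric.ball x₀ R, ‖u x‖ₑ ^ q = 0 := by
      rw [lintegral_eq_zero_iff (hcu.enorm.measurable.pow_const _)]
      filter_upwards [h0] with x hx
      have : u x = 0 := by simpa using hx
      simp [this, hq0]
    rw [this]
    exact zero_le
  -- the root mean square of `u`
  set σ : ℝ := M.toReal ^ (1 / 2 : ℝ) with hσ
  have hm : 0 < M.toReal := ENNReal.toReal_pos hM0 hMt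
  have hσ0 : 0 < σ := by positivity
  have hMσ : M = ENNReal.ofReal (σ ^ (2 : ℝ)) := by
    rw [hσ, ← Real.rpow_mul hm.le]
    norm_num [ENNReal.ofReal_toReal hMt]
  set K : ℝ := 2 ^ (n : ℝ) * (2 * R) ^ p * 2 ^ s * σ ^ (2 * p / n) with hK
  have hK0 : 0 < K := by positivity
  have hdist : ∀ t, A * σ < t → volume.restrict (Metric.ball x₀ R) {a | t < |u a|} ≤
      ENNReal.ofReal (K * t ^ (-s)) * ∫⁻ x in Metric.ball x₀ R, ‖fderiv ℝ u x‖ₑ ^ p := by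
    intro t ht
    have ht0 : 0 < t := lt_trans (by positivity) ht
    have hl0 : 0 < t / 2 := by positivity
    -- At level `λ = t / 2` the radius is determined by `r ^ (-n) σ² = λ²`.
    set r : ℝ := (σ / (t / 2)) ^ (2 / (n : ℝ)) with hr
    have hr0 : 0 < r := by positivity
    have hr2 : r ≤ 1 / 2 := by
      have h1 : σ / (t / 2) ≤ (1 / 2 : ℝ) ^ ((n : ℝ) / 2) := by
        rw [div_le_iff₀ hl0, one_div, Real.inv_rpow zero_le_two, ← div_eq_inv_mul,
          le_div_iff₀ (by positivity)]
        rw [hA] at ht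
        linarith
      calc r ≤ ((1 / 2 : ℝ) ^ ((n : ℝ) / 2)) ^ (2 / (n : ℝ)) := by rw [hr]; gcongr
        _ = 1 / 2 := by
          rw [← Real.rpow_mul (by norm_num)]
          have : (n : ℝ) / 2 * (2 / n) = 1 := by field_simp
          rw [this, Real.rpow_one]
    have hrM : ENNReal.ofReal (r ^ (-(n : ℝ))) * M ≤ ENNReal.ofReal (t / 2) ^ (2 : ℝ) := by
      rw [hMσ, ← ENNReal.ofReal_mul (by positivity),
        ENNReal.ofReal_rpow_of_nonneg hl0.le zero_le_two]
      refine ENNReal.ofReal_le_ofReal (le_of_eq ?_)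
      rw [hr, ← Real.rpow_mul (by positivity)]
      have : 2 / (n : ℝ) * -n = -2 := by field_simp
      rw [this, Real.rpow_neg (by positivity), Real.div_rpow hσ0.le hl0.le]
      field_simp
    have hw := mul_meas_lt_enorm_le_of_contDiff hu hR hr0 hr2 hp ENNReal.ofReal_ne_top hrM
    have hset : {a | t < |u a|} = {a | 2 * ENNReal.ofReal (t / 2) < ‖u a‖ₑ} := by
      ext a
      have : 2 * ENNReal.ofReal (t / 2) = ENNReal.ofReal t := by
        rw [← ENNReal.ofReal_ofNat, ← ENNReal.ofReal_mul zero_le_two]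
        congr 1; ring
      rw [mem_ofPred_eq, mem_ofPred_eq, this, Real.enorm_eq_ofReal_abs,
        ENNReal.ofReal_lt_ofReal_iff_of_nonneg ht0.le]
    rw [← hset, ENNReal.ofReal_rpow_of_nonneg hl0.le hp0.le] at hw
    have hpos : 0 < (t / 2) ^ p := by positivity
    have e : K * t ^ (-s) = ((t / 2) ^ p)⁻¹ * (2 ^ (n : ℝ) * (2 * R * r) ^ p) := by
      have e1 : r ^ p = σ ^ (2 * p / n) / (t / 2) ^ (2 * p / n) := by
        rw [hr, ← Real.rpow_mul (by positivity), ← Real.div_rpow hσ0.le hl0.le]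
        congr 1; ring
      have e2 : t ^ (-s) = ((t / 2) ^ p)⁻¹ * ((t / 2) ^ (2 * p / n))⁻¹ * (2 ^ s)⁻¹ := by
        rw [← mul_inv, ← Real.rpow_add hl0, ← mul_inv, ← Real.mul_rpow hl0.le zero_le_two,
          Real.rpow_neg ht0.le]
        congr 3; ring
      rw [Real.mul_rpow (by positivity) hr0.le, e1, e2, hK]
      field_simp
    rw [e, ENNReal.ofReal_mul (by positivity), ENNReal.ofReal_inv_of_pos hpos, mul_assoc]
    rw [← ENNReal.div_eq_inv_mul, ENNReal.le_div_iff_mul_le (by simp [hpos]) (by simp), mul_comm]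
    exact hw
  have hmain := lintegral_rpow_le_of_meas_lt_le (μ := volume.restrict (Metric.ball x₀ R))
    (f := fun x => |u x|) (Filter.Eventually.of_forall fun x => abs_nonneg _)
    hcu.abs.measurable.aemeasurable hp hpq.le (by linarith : q < s) (by positivity : 0 < A * σ)
    hK0.le hdist
  simp only [hnorm q hq0.le, hnorm p hp0.le] at hmain
  refine hmain.trans ?_
  have e1 : ENNReal.ofReal ((A * σ) ^ (q - p)) = ENNReal.ofReal c₁ * M ^ ((q - p) / 2) := by
    rw [hMσ, ENNReal.ofReal_rpow_of_nonneg (by positivity) (by linarith),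
      ← ENNReal.ofReal_mul hc₁0.le, Real.mul_rpow hA0.le hσ0.le, ← Real.rpow_mul hσ0.le]
    congr 3; ring
  have e2 : ENNReal.ofReal (K * ((A * σ) ^ (q - s) / (s - q))) =
      ENNReal.ofReal c₂ * M ^ ((q - p) / 2) * ENNReal.ofReal (R ^ p) := by
    rw [hMσ, ENNReal.ofReal_rpow_of_nonneg (by positivity) (by linarith),
      ← ENNReal.ofReal_mul hc₂0.le, ← ENNReal.ofReal_mul (by positivity),
      Real.mul_rpow hA0.le hσ0.le, ← Real.rpow_mul hσ0.le]
    have : σ ^ (2 * ((q - p) / 2)) = σ ^ (2 * p / n) * σ ^ (q - s) := by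
      rw [← Real.rpow_add hσ0]; congr 1; rw [hs]; ring
    rw [this, hK, hc₂, Real.mul_rpow zero_le_two hR.le]
    congr 1; ring
  rw [e1, e2, ENNReal.ofReal_mul hq0.le, ENNReal.ofReal_add hc₁0.le hc₂0.le]
  rw [mul_assoc (ENNReal.ofReal q), mul_assoc (ENNReal.ofReal q)]
  gcongr
  rw [mul_add, mul_assoc _ (ENNReal.ofReal (R ^ p))]
  gcongr
  · exact le_self_add
  · exact le_add_self

/-! ### Mollification of functions with a weak gradient -/

/-- Mollification is a contraction of `L^s` for `s ≥ 1`. -/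
theorem lintegral_normed_convolution_rpow_le {n : ℕ} {F : Type*} [NormedAddCommGroup F]
    [NormedSpace ℝ F] (φ : ContDiffBump (0 : Rn n)) {g : Rn n → F}
    (hg : AEStronglyMeasurable g volume) {s : ℝ} (hs : 1 ≤ s) :
    ∫⁻ x, ‖(φ.normed volume ⋆[lsmul ℝ ℝ, volume] g) x‖ₑ ^ s ≤ ∫⁻ x, ‖g x‖ₑ ^ s := by
  -- The convolution depends only on the almost everywhere class of `g`.
  wlog hg' : StronglyMeasurable g generalizing g
  · have h := this hg.stronglyMeasurable_mk.aestronglyMeasurable hg.stronglyMeasurable_mk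
    rw [← convolution_congr _ (Filter.EventuallyEq.refl _ _) hg.ae_eq_mk] at h
    refine h.trans (le_of_eq (lintegral_congr_ae ?_))
    filter_upwards [hg.ae_eq_mk] with x hx
    rw [hx]
  set w : Rn n → ℝ≥0∞ := fun t => ENNReal.ofReal (φ.normed volume t) with hw
  have hwm : Measurable w := φ.continuous_normed.measurable.ennreal_ofReal
  set ν : Measure (Rn n) := volume.withDensity w with hν
  have hprob : IsProbabilityMeasure ν := ⟨by
    rw [hν, withDensity_apply _ MeasurableSet.univ, Measure.restrict_univ,
      ← ofReal_integral_eq_lintegral_ofReal φ.integrable_normed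
        (Filter.Eventually.of_forall φ.nonneg_normed), φ.integral_normed, ENNReal.ofReal_one]⟩
  have hgm : Measurable fun z : Rn n × Rn n => ‖g (z.1 - z.2)‖ₑ :=
    (hg'.comp_measurable (measurable_fst.sub measurable_snd)).enorm
  have hgx : ∀ x, Measurable fun t => ‖g (x - t)‖ₑ := fun x =>
    hgm.comp (measurable_const.prodMk measurable_id)
  have hpt : ∀ x, ‖(φ.normed volume ⋆[lsmul ℝ ℝ, volume] g) x‖ₑ ^ s ≤
      ∫⁻ t, ‖g (x - t)‖ₑ ^ s ∂ν := by
    intro x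
    refine le_trans ?_ (rpow_lintegral_le_lintegral_rpow (hgx x).aemeasurable hs)
    gcongr
    rw [convolution_lsmul, hν, lintegral_withDensity_eq_lintegral_mul _ hwm (hgx x)]
    refine (enorm_integral_le_lintegral_enorm _).trans (le_of_eq ?_)
    refine lintegral_congr fun t => ?_
    rw [enorm_smul, Pi.mul_apply, hw, Real.enorm_of_nonneg (φ.nonneg_normed t)]
  calc _ ≤ ∫⁻ x, ∫⁻ t, ‖g (x - t)‖ₑ ^ s ∂ν := lintegral_mono hpt
    _ = ∫⁻ t, (∫⁻ x, ‖g (x - t)‖ₑ ^ s) ∂ν :=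
        lintegral_lintegral_swap (hgm.pow_const s).aemeasurable
    _ = ∫⁻ _, (∫⁻ x, ‖g x‖ₑ ^ s) ∂ν := by
        congr 1 with t
        exact lintegral_sub_right_eq_self (fun x => ‖g x‖ₑ ^ s) t
    _ = _ := by rw [lintegral_const, measure_univ, mul_one]

/-- At points whose `φ.rOut`-neighbourhood lies in the compact set `K`, the derivative of the
mollification of `u` is the mollification of the weak gradient. Cutting off with the indicator of `K`
makes both functions globally integrable and changes nothing at such points. -/
theorem enorm_fderiv_normed_convolution_le {n : ℕ} {U K : Set (Rn n)} {u : Rn n → ℝ}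
    {g : Rn n → Rn n} (h : IsWeakGradient U u g) (hK : IsCompact K) (hKU : K ⊆ U)
    (φ : ContDiffBump (0 : Rn n)) {x : Rn n} (hx : Metric.closedBall x φ.rOut ⊆ K) :
    ‖fderiv ℝ (φ.normed volume ⋆[lsmul ℝ ℝ, volume] K.indicator u) x‖ₑ ≤
      ‖(φ.normed volume ⋆[lsmul ℝ ℝ, volume] K.indicator g) x‖ₑ := by
  obtain ⟨hu, hg, hw⟩ := h
  have hKm := hK.measurableSet
  have hui : LocallyIntegrable (K.indicator u) volume :=
    ((hu.integrableOn_compact_subset hKU hK).integrable_indicator hKm).locallyIntegrable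
  have hgi : LocallyIntegrable (K.indicator g) volume :=
    ((hg.integrableOn_compact_subset hKU hK).integrable_indicator hKm).locallyIntegrable
  set η : Rn n → ℝ := φ.normed volume with hη
  have hηc : HasCompactSupport η := φ.hasCompactSupport_normed
  have hηs : ContDiff ℝ ∞ η := φ.contDiff_normed
  have hη1 : ContDiff ℝ 1 η := φ.contDiff_normed
  have hsupp : ∀ t, t ∉ K → t ∉ Metric.closedBall x φ.rOut := fun t ht h => ht (hx h)
  have hη0 : ∀ t, t ∉ K → η (x - t) = 0 := by
    intro t ht
    apply image_eq_zero_of_notMem_tsupport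
    rw [hη, φ.tsupport_normed_eq, mem_closedBall_zero_iff, ← dist_eq_norm, dist_comm]
    exact hsupp t ht
  have hη'0 : ∀ t, t ∉ K → fderiv ℝ η (x - t) = 0 := by
    intro t ht
    have : x - t ∉ tsupport η := by
      rw [hη, φ.tsupport_normed_eq, mem_closedBall_zero_iff, ← dist_eq_norm, dist_comm]
      exact hsupp t ht
    exact image_eq_zero_of_notMem_tsupport fun h => this (tsupport_fderiv_subset ℝ h)
  have hcomp : ∀ i : Fin n, fderiv ℝ (η ⋆[lsmul ℝ ℝ, volume] K.indicator u) x
      (EuclideanSpace.single i 1) = (η ⋆[lsmul ℝ ℝ, volume] K.indicator g) x i := by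
    intro i
    have hex := (hηc.fderiv ℝ).convolutionExists_left
      (L := (lsmul ℝ ℝ : ℝ →L[ℝ] ℝ →L[ℝ] ℝ).precompL (Rn n))
      (hη1.continuous_fderiv one_ne_zero) hui x
    have hex2 := hηc.convolutionExists_left (L := (lsmul ℝ ℝ : ℝ →L[ℝ] Rn n →L[ℝ] Rn n))
      hη1.continuous hgi x
    -- The test function in the definition of the weak gradient is `t ↦ η (x - t)`.
    have hψ : ContDiff ℝ ∞ (fun t => η (x - t)) := hηs.comp (contDiff_const.sub contDiff_id)
    have hψd : ∀ t, fderiv ℝ (fun t => η (x - t)) t (EuclideanSpace.single i 1) =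
        - fderiv ℝ η (x - t) (EuclideanSpace.single i 1) := by
      intro t
      have h1 : HasFDerivAt (fun t => η (x - t))
          ((fderiv ℝ η (x - t)).comp (-ContinuousLinearMap.id ℝ (Rn n))) t := by
        refine ((hη1.differentiable one_ne_zero) (x - t)).hasFDerivAt.comp t ?_
        exact (hasFDerivAt_id t).const_sub x
      rw [h1.fderiv]
      simp
    have hψs : tsupport (fun t => η (x - t)) ⊆ K := by
      refine closure_minimal (fun t ht => ?_) hK.isClosed
      by_contra hc
      exact ht (hη0 t hc)
    have hψc : HasCompactSupport (fun t => η (x - t)) :=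
      hK.of_isClosed_subset (isClosed_tsupport _) hψs
    have key := hw _ hψ hψc (hψs.trans hKU) i
    rw [setIntegral_eq_integral_of_forall_compl_eq_zero,
      setIntegral_eq_integral_of_forall_compl_eq_zero] at key
    rotate_left
    · intro t ht
      rw [hη0 t fun h => ht (hKU h), mul_zero]
    · intro t ht
      rw [hψd, hη'0 t fun h => ht (hKU h)]
      simp
    simp only [hψd, mul_neg, integral_neg, neg_inj] at key
    calc fderiv ℝ (η ⋆[lsmul ℝ ℝ, volume] K.indicator u) x (EuclideanSpace.single i 1)
        = ∫ t, u t * fderiv ℝ η (x - t) (EuclideanSpace.single i 1) := by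
          rw [(hηc.hasFDerivAt_convolution_left (lsmul ℝ ℝ) hη1 hui x).fderiv, convolution_eq_swap,
            ContinuousLinearMap.integral_apply hex.integrable_swap]
          refine integral_congr_ae (Filter.Eventually.of_forall fun t => ?_)
          by_cases ht : t ∈ K
          · simp [ht, ContinuousLinearMap.precompL_apply, mul_comm]
          · simp [ht, hη'0 t ht]
      _ = ∫ t, g t i * η (x - t) := key
      _ = ∫ t, EuclideanSpace.proj (𝕜 := ℝ) i (lsmul ℝ ℝ (η (x - t)) (K.indicator g t)) := by
          refine integral_congr_ae (Filter.Eventually.of_forall fun t => ?_)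
          by_cases ht : t ∈ K
          · simp [ht, mul_comm]
          · simp [ht, hη0 t ht]
      _ = (η ⋆[lsmul ℝ ℝ, volume] K.indicator g) x i := by
          rw [ContinuousLinearMap.integral_comp_comm _ hex2.integrable_swap, convolution_eq_swap]
          rfl
  -- the derivative is the pairing with the mollified gradient
  have hinner : fderiv ℝ (η ⋆[lsmul ℝ ℝ, volume] K.indicator u) x =
      innerSL ℝ ((η ⋆[lsmul ℝ ℝ, volume] K.indicator g) x) := by
    apply ContinuousLinearMap.coe_injective
    refine (EuclideanSpace.basisFun (Fin n) ℝ).toBasis.ext fun i => ?_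
    simp [hcomp, EuclideanSpace.inner_single_right]
  rw [hinner, ← ofReal_norm, ← ofReal_norm, innerSL_apply_norm]

/-! ### The interpolation inequality for weak gradients and its integration in time -/

/-- The interpolation inequality passes from `C¹` functions to functions `u` with a weak gradient, at
the price of a smaller ball on the left: mollify `u` at scales below the distance of the two
spheres, and apply Fatou's lemma. The volume of the ball of radius `R / 2` makes the bound independent
of the smaller radius `ρ`. -/
theorem lintegral_smaller_ball_le_of_isWeakGradient {n : ℕ} {p q C R ρ : ℝ} (hp : 1 ≤ p)
    (hpq : p < q) {x₀ : Rn n} (hR : 0 < R) (hρR : ρ < R) (hRρ : R / 2 ≤ ρ)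
    (hC : ∀ v : Rn n → ℝ, ContDiff ℝ 1 v →
      ∫⁻ x in Metric.ball x₀ ρ, ‖v x‖ₑ ^ q ≤ ENNReal.ofReal C *
        ((volume (Metric.ball x₀ ρ))⁻¹ *
          ∫⁻ x in Metric.ball x₀ ρ, ‖v x‖ₑ ^ (2 : ℝ)) ^ ((q - p) / 2) *
        ((∫⁻ x in Metric.ball x₀ ρ, ‖v x‖ₑ ^ p) +
          ENNReal.ofReal (ρ ^ p) * ∫⁻ x in Metric.ball x₀ ρ, ‖fderiv ℝ v x‖ₑ ^ p))
    {u : Rn n → ℝ} {g : Rn n → Rn n} (h : IsWeakGradient (Metric.ball x₀ R) u g) :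
    ∫⁻ x in Metric.ball x₀ ρ, ‖u x‖ₑ ^ q ≤ ENNReal.ofReal C *
        ((volume (Metric.ball x₀ (R / 2)))⁻¹ *
          ∫⁻ x in Metric.ball x₀ R, ‖u x‖ₑ ^ (2 : ℝ)) ^ ((q - p) / 2) *
        ((∫⁻ x in Metric.ball x₀ R, ‖u x‖ₑ ^ p) +
          ENNReal.ofReal (R ^ p) * ∫⁻ x in Metric.ball x₀ R, ‖g x‖ₑ ^ p) := by
  have hp0 : 0 < p := by linarith
  set δ : ℝ := (R - ρ) / 2 with hδ
  have hδ0 : 0 < δ := by rw [hδ]; linarith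
  set K : Set (Rn n) := Metric.closedBall x₀ (ρ + δ) with hKdef
  have hK : IsCompact K := isCompact_closedBall _ _
  have hKU : K ⊆ Metric.ball x₀ R := Metric.closedBall_subset_ball (by rw [hδ]; linarith)
  have hui : Integrable (K.indicator u) volume :=
    (h.1.integrableOn_compact_subset hKU hK).integrable_indicator hK.measurableSet
  have hgi : Integrable (K.indicator g) volume :=
    (h.2.1.integrableOn_compact_subset hKU hK).integrable_indicator hK.measurableSet
  -- mollifiers supported in balls of radius at most `δ`
  have hrad : ∀ k : ℕ, 0 < δ / ((k : ℝ) + 1) := fun k => by positivity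
  let φ : ℕ → ContDiffBump (0 : Rn n) := fun k =>
    { rIn := δ / ((k : ℝ) + 1) / 2
      rOut := δ / ((k : ℝ) + 1)
      rIn_pos := half_pos (hrad k)
      rIn_lt_rOut := half_lt_self (hrad k) }
  have hφδ : ∀ k, (φ k).rOut ≤ δ := fun k =>
    div_le_self hδ0.le (by simp)
  have hφlim : Filter.Tendsto (fun k => (φ k).rOut) Filter.atTop (𝓝 0) :=
    by simpa [φ, div_eq_mul_inv] using
      (tendsto_one_div_add_atTop_nhds_zero_nat (𝕜 := ℝ)).const_mul δ
  set v : ℕ → Rn n → ℝ := fun k => (φ k).normed volume ⋆[lsmul ℝ ℝ, volume] K.indicator u with hv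
  have hvs : ∀ k, ContDiff ℝ 1 (v k) := fun k =>
    (φ k).hasCompactSupport_normed.contDiff_convolution_left (n := 1) (lsmul ℝ ℝ)
      (φ k).contDiff_normed hui.locallyIntegrable
  have hind : ∀ {F : Type} [NormedAddCommGroup F] (w : Rn n → F) (s : ℝ), 1 ≤ s →
      ∫⁻ x, ‖K.indicator w x‖ₑ ^ s ≤ ∫⁻ x in Metric.ball x₀ R, ‖w x‖ₑ ^ s := by
    intro F _ w s hs
    have : ∀ x, ‖K.indicator w x‖ₑ ^ s = K.indicator (fun x => ‖w x‖ₑ ^ s) x := fun x => by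
      by_cases hx : x ∈ K
      · simp [hx]
      · simp [hx, show 0 < s by linarith]
    simp only [this]
    rw [lintegral_indicator hK.measurableSet]
    exact lintegral_mono_set hKU
  have hvL : ∀ k (s : ℝ), 1 ≤ s → ∫⁻ x in Metric.ball x₀ ρ, ‖v k x‖ₑ ^ s ≤
      ∫⁻ x in Metric.ball x₀ R, ‖u x‖ₑ ^ s := fun k s hs =>
    (setLIntegral_le_lintegral _ _).trans
      ((lintegral_normed_convolution_rpow_le (φ k) hui.1 hs).trans (hind u s hs))
  have hDL : ∀ k, ∫⁻ x in Metric.ball x₀ ρ, ‖fderiv ℝ (v k) x‖ₑ ^ p ≤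
      ∫⁻ x in Metric.ball x₀ R, ‖g x‖ₑ ^ p := by
    intro k
    refine le_trans (setLIntegral_mono' measurableSet_ball fun x hx => ?_)
      ((setLIntegral_le_lintegral _ _).trans
        ((lintegral_normed_convolution_rpow_le (φ k) hgi.1 hp).trans (hind g p hp)))
    gcongr
    refine enorm_fderiv_normed_convolution_le h hK hKU (φ k)
      (Metric.closedBall_subset_closedBall' ?_)
    have := Metric.mem_ball.1 hx
    linarith [hφδ k]
  have hbound : ∀ k, ∫⁻ x in Metric.ball x₀ ρ, ‖v k x‖ₑ ^ q ≤ ENNReal.ofReal C *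
        ((volume (Metric.ball x₀ (R / 2)))⁻¹ *
          ∫⁻ x in Metric.ball x₀ R, ‖u x‖ₑ ^ (2 : ℝ)) ^ ((q - p) / 2) *
        ((∫⁻ x in Metric.ball x₀ R, ‖u x‖ₑ ^ p) +
          ENNReal.ofReal (R ^ p) * ∫⁻ x in Metric.ball x₀ R, ‖g x‖ₑ ^ p) := by
    intro k
    refine (hC (v k) (hvs k)).trans ?_
    have hqp : 0 ≤ (q - p) / 2 := by linarith
    gcongr ENNReal.ofReal C * (?_ * ?_) ^ _ * (?_ + ENNReal.ofReal (?_ ^ p) * ?_)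
    · gcongr
    · exact hvL k 2 one_le_two
    · exact hvL k p hp
    · linarith
    · exact hDL k
  have hlim : ∀ᵐ x ∂(volume.restrict (Metric.ball x₀ ρ)),
      Filter.liminf (fun k => ‖v k x‖ₑ ^ q) Filter.atTop = ‖u x‖ₑ ^ q := by
    have := ContDiffBump.ae_convolution_tendsto_right_of_locallyIntegrable (μ := volume) (K := 2)
      hφlim (Filter.Eventually.of_forall fun k => by simp [φ]; linarith) hui.locallyIntegrable
    filter_upwards [ae_restrict_of_ae this, ae_restrict_mem measurableSet_ball] with x hx hxB
    have hxK : x ∈ K := Metric.ball_subset_closedBall.trans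
      (Metric.closedBall_subset_closedBall (by linarith)) hxB
    rw [indicator_of_mem hxK] at hx
    exact ((ENNReal.continuous_rpow_const.tendsto _).comp
      ((continuous_enorm.tendsto _).comp hx)).liminf_eq
  calc ∫⁻ x in Metric.ball x₀ ρ, ‖u x‖ₑ ^ q
      = ∫⁻ x in Metric.ball x₀ ρ, Filter.liminf (fun k => ‖v k x‖ₑ ^ q) Filter.atTop :=
        lintegral_congr_ae (hlim.mono fun x hx => hx.symm)
    _ ≤ Filter.liminf (fun k => ∫⁻ x in Metric.ball x₀ ρ, ‖v k x‖ₑ ^ q) Filter.atTop :=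
        lintegral_liminf_le fun k => (hvs k).continuous.enorm.measurable.pow_const _
    _ ≤ _ := by
        refine Filter.liminf_le_of_le (by isBoundedDefault) fun b hb => ?_
        obtain ⟨k, hk⟩ := hb.exists
        exact hk.trans (hbound k)

/-- The interpolation inequality on balls for functions with a weak gradient. No integrability beyond
`IsWeakGradient` is needed, as either side may be infinite. -/
theorem gagliardo_nirenberg_ball_of_isWeakGradient {n : ℕ} (hn : 0 < n) {p q : ℝ} (hp : 1 ≤ p)
    (hpq : p < q) (hq : q < p + 2 * p / n) :
    ∃ C : ℝ, 0 < C ∧ ∀ (x₀ : Rn n) (R : ℝ) (u : Rn n → ℝ) (g : Rn n → Rn n), 0 < R →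
      IsWeakGradient (Metric.ball x₀ R) u g →
      ∫⁻ x in Metric.ball x₀ R, ‖u x‖ₑ ^ q ≤ ENNReal.ofReal C *
        ((volume (Metric.ball x₀ R))⁻¹ *
          ∫⁻ x in Metric.ball x₀ R, ‖u x‖ₑ ^ (2 : ℝ)) ^ ((q - p) / 2) *
        ((∫⁻ x in Metric.ball x₀ R, ‖u x‖ₑ ^ p) +
          ENNReal.ofReal (R ^ p) * ∫⁻ x in Metric.ball x₀ R, ‖g x‖ₑ ^ p) := by
  obtain ⟨C, hC0, hC⟩ := gagliardo_nirenberg_ball_of_contDiff hn hp hpq hq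
  have hqp : 0 ≤ (q - p) / 2 := by linarith
  refine ⟨C * (2 ^ n) ^ ((q - p) / 2), by positivity, fun x₀ R u g hR h => ?_⟩
  have hvol : (volume (Metric.ball x₀ (R / 2)))⁻¹ =
      ENNReal.ofReal (2 ^ n) * (volume (Metric.ball x₀ R))⁻¹ := by
    have := Measure.addHaar_ball_mul_of_pos (volume : Measure (Rn n)) x₀
      (show (0 : ℝ) < 2⁻¹ by norm_num) R
    rw [show R / 2 = 2⁻¹ * R by ring, this, ENNReal.mul_inv (by left; simp) (by left; simp),
      ← Measure.addHaar_ball_center volume x₀ R, finrank_euclideanSpace_fin,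
      ← ENNReal.ofReal_inv_of_pos (by positivity)]
    simp
  -- The ball is exhausted by balls of radius `ρ k ∈ [R / 2, R)`.
  set ρ : ℕ → ℝ := fun k => R - R / 2 / ((k : ℝ) + 1) with hρ
  have hmono : Monotone ρ := fun i j hij => by
    simp only [hρ]
    gcongr
  have hUn : Metric.ball x₀ R = ⋃ k, Metric.ball x₀ (ρ k) := by
    refine subset_antisymm (fun x hx => ?_)
      (iUnion_subset fun k => Metric.ball_subset_ball (sub_le_self R (by positivity)))
    have hd : 0 < (R - dist x x₀) / (R / 2) := div_pos (sub_pos.2 hx) (by positivity)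
    obtain ⟨k, hk⟩ := exists_nat_one_div_lt hd
    refine mem_iUnion.2 ⟨k, ?_⟩
    rw [Metric.mem_ball]
    rw [lt_div_iff₀ (by positivity)] at hk
    have : R / 2 / ((k : ℝ) + 1) = 1 / ((k : ℝ) + 1) * (R / 2) := by ring
    simp only [hρ, this]
    linarith
  rw [hUn, setLIntegral_iUnion_of_directed _
    (Monotone.directed_le fun i j hij => Metric.ball_subset_ball (hmono hij)), ← hUn]
  refine iSup_le fun k => ?_
  have hk1 : 0 < R / 2 / ((k : ℝ) + 1) := by positivity
  have hk2 : R / 2 / ((k : ℝ) + 1) ≤ R / 2 := div_le_self (by positivity) (by simp)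
  have := lintegral_smaller_ball_le_of_isWeakGradient hp hpq hR (ρ := ρ k)
    (by simp only [hρ]; linarith) (by simp only [hρ]; linarith)
    (fun v hv => hC v x₀ _ hv (by simp only [hρ]; linarith)) h
  refine this.trans (le_of_eq ?_)
  rw [hvol, mul_assoc (ENNReal.ofReal (2 ^ n)), ENNReal.mul_rpow_of_nonneg _ _ hqp,
    ENNReal.ofReal_rpow_of_nonneg (by positivity) hqp, ENNReal.ofReal_mul hC0.le, ← mul_assoc]

/-- The interpolation inequality in scale-invariant form. -/
theorem gagliardo_nirenberg_ball_normalized {n : ℕ} (hn : 0 < n) {p q : ℝ} (hp : 1 ≤ p)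
    (hpq : p < q) (hq : q < p + 2 * p / n) :
    ∃ C : ℝ, 0 < C ∧ ∀ (x₀ : Rn n) (R : ℝ) (u : Rn n → ℝ) (g : Rn n → Rn n), 0 < R →
      IsWeakGradient (Metric.ball x₀ R) u g →
      ∫⁻ x in Metric.ball x₀ R, ‖u x / R‖ₑ ^ q ≤ ENNReal.ofReal C *
        (∫⁻ x in Metric.ball x₀ R, (‖g x‖ₑ ^ p + ‖u x / R‖ₑ ^ p)) *
        (⨍⁻ x in Metric.ball x₀ R, ‖u x / R‖ₑ ^ (2 : ℝ) ∂volume) ^ ((q - p) / 2) := by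
  obtain ⟨C, hC0, hC⟩ := gagliardo_nirenberg_ball_of_isWeakGradient hn hp hpq hq
  refine ⟨C, hC0, fun x₀ R u g hR h => ?_⟩
  have hqp : 0 ≤ (q - p) / 2 := by linarith
  have hp0 : 0 < p := by linarith
  have hsc : ∀ a : ℝ, 0 ≤ a → ∀ x,
      ‖u x / R‖ₑ ^ a = ENNReal.ofReal (R ^ (-a)) * ‖u x‖ₑ ^ a := by
    intro a ha x
    rw [Real.rpow_neg hR.le, ← Real.inv_rpow hR.le,
      ← ENNReal.ofReal_rpow_of_nonneg (by positivity) ha, ← ENNReal.mul_rpow_of_nonneg _ _ ha,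
      div_eq_inv_mul, enorm_mul, Real.enorm_of_nonneg (by positivity : 0 ≤ R⁻¹)]
  have hgm : AEMeasurable (fun x => ‖g x‖ₑ ^ p) (volume.restrict (Metric.ball x₀ R)) :=
    h.2.1.aestronglyMeasurable.enorm.pow_const p
  rw [lintegral_add_left' hgm, setLAverage_eq]
  simp only [hsc q (by linarith), hsc p hp0.le, hsc 2 zero_le_two]
  rw [lintegral_const_mul' _ _ ENNReal.ofReal_ne_top, lintegral_const_mul' _ _ ENNReal.ofReal_ne_top,
    lintegral_const_mul' _ _ ENNReal.ofReal_ne_top]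
  refine (mul_le_mul_right (hC x₀ R u g hR h) _).trans (le_of_eq ?_)
  have e1 : ENNReal.ofReal (R ^ (-q)) = ENNReal.ofReal (R ^ (-p)) *
      ENNReal.ofReal (R ^ (-2 : ℝ)) ^ ((q - p) / 2) := by
    rw [ENNReal.ofReal_rpow_of_nonneg (by positivity) hqp, ← ENNReal.ofReal_mul (by positivity),
      ← Real.rpow_mul hR.le, ← Real.rpow_add hR]
    congr 2; ring
  have e2 : ENNReal.ofReal (R ^ (-p)) * ENNReal.ofReal (R ^ p) = 1 := by
    rw [← ENNReal.ofReal_mul (by positivity), ← Real.rpow_add hR]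
    simp
  rw [e1, ENNReal.div_eq_inv_mul, mul_left_comm _ (ENNReal.ofReal (R ^ (-2 : ℝ))),
    ENNReal.mul_rpow_of_nonneg (ENNReal.ofReal (R ^ (-2 : ℝ))) _ hqp]
  set X := ENNReal.ofReal (R ^ (-2 : ℝ)) ^ ((q - p) / 2)
  set Y := ((volume (Metric.ball x₀ R))⁻¹ *
    ∫⁻ x in Metric.ball x₀ R, ‖u x‖ₑ ^ (2 : ℝ)) ^ ((q - p) / 2)
  set G := ∫⁻ x in Metric.ball x₀ R, ‖g x‖ₑ ^ p
  set P := ∫⁻ x in Metric.ball x₀ R, ‖u x‖ₑ ^ p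
  calc _ = ENNReal.ofReal C * ((ENNReal.ofReal (R ^ (-p)) * ENNReal.ofReal (R ^ p)) * G +
        ENNReal.ofReal (R ^ (-p)) * P) * (X * Y) := by ring
    _ = _ := by rw [e2, one_mul]

theorem lemma3p1 (n : ℕ) (hn : 2 ≤ n) (p q : ℝ) (hp : 2 ≤ p) (hpq : p < q)
    (hq : q < p + p / ((n : ℝ) - 1)) :
    ∃ θ c : ℝ, 0 < θ ∧ θ < 1 ∧ 1 < c ∧
      ∀ (x₀ : Rn n) (t₀ R ℓ : ℝ), 0 < R → 0 < ℓ →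
      ∀ f : Rn n × ℝ → ℝ,
        MemCL2 (timeInterval t₀ ℓ) (Metric.ball x₀ R) f →
        MemLpW1p p (timeInterval t₀ ℓ) (Metric.ball x₀ R) f →
      ∀ Df : Rn n × ℝ → Rn n,
        IsSpatialGradient (timeInterval t₀ ℓ) (Metric.ball x₀ R) f Df →
        (⨍⁻ z in parabolicCylinder x₀ t₀ R ℓ, ‖f z / R‖ₑ ^ q ∂volume) ≤
          ENNReal.ofReal c *
            (⨍⁻ z in parabolicCylinder x₀ t₀ R ℓ,
              (‖Df z‖ₑ ^ p + ‖f z / R‖ₑ ^ p) ∂volume) ^ (q * θ / p) *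
            (⨆ t ∈ timeInterval t₀ ℓ,
              ⨍⁻ x in Metric.ball x₀ R, ‖f (x, t) / R‖ₑ ^ (2 : ℝ) ∂volume) ^ (q * (1 - θ) / 2) := by
  have hp0 : 0 < p := by linarith
  have hq0 : 0 < q := by linarith
  have hn2 : (2 : ℝ) ≤ n := by exact_mod_cast hn
  -- the range of exponents is subcritical
  have hq' : q < p + 2 * p / n := by
    refine hq.trans_le ?_
    refine add_le_add le_rfl ?_
    rw [div_le_div_iff₀ (by linarith) (by linarith)]
    nlinarith
  obtain ⟨C, hC0, hC⟩ :=
    gagliardo_nirenberg_ball_normalized (by lia : 0 < n) (by linarith : 1 ≤ p) hpq hq'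
  -- with `θ = p / q` the first factor is linear in the energy
  refine ⟨p / q, C + 1, by positivity, (div_lt_one hq0).2 hpq, by linarith,
    fun x₀ t₀ R ℓ hR hℓ f _ hf Df hDf => ?_⟩
  have hθ1 : q * (p / q) / p = 1 := by field_simp
  have hθ2 : q * (1 - p / q) / 2 = (q - p) / 2 := by field_simp
  rw [hθ1, hθ2, ENNReal.rpow_one]
  set I := timeInterval t₀ ℓ with hI
  set B := Metric.ball x₀ R with hB
  set S := ⨆ t ∈ I, ⨍⁻ x in B, ‖f (x, t) / R‖ₑ ^ (2 : ℝ) ∂volume with hS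
  have hIm : MeasurableSet I := measurableSet_Ioo
  have hprod : (volume : Measure (Rn n × ℝ)).restrict (B ×ˢ I) =
      (volume.restrict B).prod (volume.restrict I) := by
    rw [Measure.volume_eq_prod, Measure.prod_restrict]
  have hfm : AEMeasurable f ((volume.restrict B).prod (volume.restrict I)) := by
    rw [← hprod]; exact hf.1.1.aemeasurable
  have hDm : AEMeasurable Df ((volume.restrict B).prod (volume.restrict I)) := by
    rw [← hprod]; exact hDf.1.aemeasurable
  have hfs : ∀ a : ℝ, AEMeasurable (fun z => ‖f z / R‖ₑ ^ a)
      ((volume.restrict B).prod (volume.restrict I)) := fun a =>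
    (hfm.div_const R).enorm.pow_const a
  have hint : ∫⁻ z in B ×ˢ I, ‖f z / R‖ₑ ^ q ≤ ENNReal.ofReal C *
      (∫⁻ z in B ×ˢ I, (‖Df z‖ₑ ^ p + ‖f z / R‖ₑ ^ p)) * S ^ ((q - p) / 2) := by
    have hsum : AEMeasurable (fun z => ‖Df z‖ₑ ^ p + ‖f z / R‖ₑ ^ p)
        ((volume.restrict B).prod (volume.restrict I)) := (hDm.enorm.pow_const p).add (hfs p)
    have hslice : AEMeasurable (fun t => ∫⁻ x in B, (‖Df (x, t)‖ₑ ^ p + ‖f (x, t) / R‖ₑ ^ p))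
        (volume.restrict I) := hsum.prod_swap.lintegral_prod_right'
    rw [hprod, lintegral_prod_symm _ (hfs q), lintegral_prod_symm _ hsum,
      mul_right_comm, ← lintegral_const_mul'' _ hslice]
    refine lintegral_mono_ae ?_
    filter_upwards [hDf.2, ae_restrict_mem hIm] with t ht htI
    refine (hC x₀ R _ _ hR ht).trans ?_
    rw [mul_right_comm]
    have hqp : 0 ≤ (q - p) / 2 := by linarith
    gcongr
    exact le_iSup₂ (f := fun t _ => ⨍⁻ x in B, ‖f (x, t) / R‖ₑ ^ (2 : ℝ) ∂volume) t htI
  rw [show parabolicCylinder x₀ t₀ R ℓ = B ×ˢ I from rfl, setLAverage_eq, setLAverage_eq]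
  calc _ ≤ (ENNReal.ofReal C * (∫⁻ z in B ×ˢ I, (‖Df z‖ₑ ^ p + ‖f z / R‖ₑ ^ p)) *
        S ^ ((q - p) / 2)) / volume (B ×ˢ I) := by gcongr
    _ = ENNReal.ofReal C * ((∫⁻ z in B ×ˢ I, (‖Df z‖ₑ ^ p + ‖f z / R‖ₑ ^ p)) /
        volume (B ×ˢ I)) * S ^ ((q - p) / 2) := by
        simp only [ENNReal.div_eq_inv_mul]
        ring
    _ ≤ _ := by
        gcongr
        linarith
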